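/- Let $M$ be a smooth manifold (Hausdorff, without boundary) of dimension $4n$, and let $Q\subset \mathrm{End}(TM)$ be a smooth subbundle of rank $3$ which at every point $x\in M$ is spanned by endomorphisms $I_1,I_2,I_3$ of $T_xM$ with $I_1^2=I_2^2=I_3^2=-\mathrm{id}$ and $I_1I_2=-I_2I_1=I_3$. Let $\nabla$ be a quaternionic connection on $(M,Q)$, that is, a torsion-free smooth connection on $TM$ whose induced connection on $\mathrm{End}(TM)$ preserves $Q$ ($\nabla_Y\Gamma(Q)\subset\Gamma(Q)$ for all $Y\in\Gamma(TM)$). Let $X$ be a quaternionic vector field, that is, a smooth vector field whose local flow $\varphi_t$ satisfies $\varphi_{t*}\circ I\circ\varphi_{t*}^{-1}\in Q$ for all $I\in Q$ and all $t$. For vector fields $Y,Z$ put $$(L_X\nabla)_YZ=[X,\nabla_YZ]-\nabla_{[X,Y]}Z-\nabla_Y[X,Z],$$ and let $\mathrm{Ric}^\nabla(Y,Z)=\mathrm{Tr}\,(U\mapsto R^\nabla_{U,Y}Z)$, where $R^\nabla_{U,Y}Z=\nabla_U\nabla_YZ-\nabla_Y\nabla_UZ-\nabla_{[U,Y]}Z$.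 Let $(\mathrm{Ric}^\nabla)^a(Y,Z)=\frac12\big(\mathrm{Ric}^\nabla(Y,Z)-\mathrm{Ric}^\nabla(Z,Y)\big)$ be the skew-symmetric part of $\mathrm{Ric}^\nabla$, and let $\nabla X$ be the field of endomorphisms $v\mapsto\nabla_vX$. Then $L_X\nabla=0$ if and only if $2(\mathrm{Ric}^\nabla)^a(X,\cdot)=d(\mathrm{Tr}\,\nabla X)$. -/

import Mathlib

open Bundle Set
open scoped Manifold ContDiff

noncomputable section

namespace QuaternionicGeometry

variable {E : Type*} [NormedAddCommGroup E] [NormedSpace ℝ E]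
  {M : Type*} [TopologicalSpace M] [ChartedSpace E M] [IsManifold 𝓘(ℝ, E) ∞ M]

variable (E M) in
/-- `Γ(TM)`: the smooth vector fields on a manifold `M` without boundary modelled on `E`. -/
abbrev VField : Type _ := Cₛ^∞⟮𝓘(ℝ, E); E, (TangentSpace 𝓘(ℝ, E) : M → Type _)⟯

variable (E) in
/-- The fibre `End (T_x M)` of the endomorphism bundle. -/
abbrev EndT (x : M) : Type _ := TangentSpace 𝓘(ℝ, E) x →L[ℝ] TangentSpace 𝓘(ℝ, E) x

/-- The field of endomorphisms `A` is a smooth section of `End (TM)` over the set `U`. -/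
def SmoothEndOn (A : Π x : M, EndT E x) (U : Set M) : Prop :=
  ContMDiffOn 𝓘(ℝ, E) (𝓘(ℝ, E).prod 𝓘(ℝ, E →L[ℝ] E)) ∞
    (fun x ↦ TotalSpace.mk' (E →L[ℝ] E) (E := fun x : M ↦ EndT E x) x (A x)) U

/-- `Γ(Q)`: the field of endomorphisms `A` is a smooth section of `End (TM)` with values in the
family of subspaces `Q`. -/
def IsSection (Q : Π x : M, Submodule ℝ (EndT E x)) (A : Π x : M, EndT E x) : Prop :=
  SmoothEndOn A univ ∧ ∀ x, A x ∈ Q x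

/-- `(I₁, I₂, I₃)` is an admissible frame of the space `q` of endomorphisms of `T_x M`: it spans
`q`, and `I₁² = I₂² = I₃² = -id`, `I₁ I₂ = - I₂ I₁ = I₃`. -/
structure IsAdmissibleFrame {x : M} (q : Submodule ℝ (EndT E x)) (I₁ I₂ I₃ : EndT E x) :
    Prop where
  sq₁ : I₁.comp I₁ = - ContinuousLinearMap.id ℝ _
  sq₂ : I₂.comp I₂ = - ContinuousLinearMap.id ℝ _
  sq₃ : I₃.comp I₃ = - ContinuousLinearMap.id ℝ _
  mul₁₂ : I₁.comp I₂ = I₃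
  mul₂₁ : - I₂.comp I₁ = I₃
  span_eq : Submodule.span ℝ {I₁, I₂, I₃} = q

/-- `Q` is a smooth subbundle of `End (TM)` of rank three which at every point has an admissible
frame. -/
structure IsQuaternionicBundle (Q : Π x : M, Submodule ℝ (EndT E x)) : Prop where
  /-- `Q` has smooth local frames consisting of three sections. -/
  subbundle : ∀ x : M, ∃ U : Set M, IsOpen U ∧ x ∈ U ∧ ∃ s : Fin 3 → Π y : M, EndT E y,
    (∀ i, SmoothEndOn (s i) U) ∧
    ∀ y ∈ U, LinearIndependent ℝ (fun i ↦ s i y) ∧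
      Submodule.span ℝ (range fun i ↦ s i y) = Q y
  admissible : ∀ x : M, ∃ I₁ I₂ I₃ : EndT E x, IsAdmissibleFrame (Q x) I₁ I₂ I₃

/-- The connection induced by `∇` on `End (TM)` preserves `Q`: for `X ∈ Γ(TM)` and `A ∈ Γ(Q)`, the
field of endomorphisms `B = ∇_X A`, which is characterised by `∇_X (A Y) = B Y + A (∇_X Y)` for all
`Y ∈ Γ(TM)`, is in `Γ(Q)`.
Here and below, `∇ Y x (X x)` is the value of `∇_X Y` at `x`. -/
def Preserves (nabla : CovariantDerivative 𝓘(ℝ, E) E (TangentSpace 𝓘(ℝ, E) : M → Type _))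
    (Q : Π x : M, Submodule ℝ (EndT E x)) : Prop :=
  ∀ (X : VField E M) (A : Π x : M, EndT E x), IsSection Q A →
    ∃ B : Π x : M, EndT E x, IsSection Q B ∧
      ∀ (Y : VField E M) (x : M),
        nabla (fun y ↦ A y (Y y)) x (X x) = B x (Y x) + A x (nabla Y x (X x))

/-- `φ` is (a restriction of) the local flow of the vector field `X`, defined for initial points in
the open set `U` and times in `(-ε, ε)`. -/
structure IsLocalFlow (X : VField E M) (U : Set M) (ε : ℝ) (φ : ℝ → M → M) : Prop where
  isOpen : IsOpen U
  pos : 0 < ε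
  smooth : ContMDiffOn (𝓘(ℝ, ℝ).prod 𝓘(ℝ, E)) 𝓘(ℝ, E) ∞
    (fun p : ℝ × M ↦ φ p.1 p.2) (Ioo (-ε) ε ×ˢ U)
  zero : ∀ x ∈ U, φ 0 x = x
  integral : ∀ x ∈ U, IsMIntegralCurveOn (I := 𝓘(ℝ, E)) (fun t ↦ φ t x) X (Ioo (-ε) ε)

/-- The vector field `X` is quaternionic: its local flow preserves `Q`, that is,
`φ_{t*} ∘ A ∘ φ_{t*}⁻¹ ∈ Q` for all `A ∈ Q`. Around each point, the local flow of `X` exists and is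
unique, and it consists of local diffeomorphisms, so that the inverse below is a true inverse. -/
def IsQuaternionicField (Q : Π x : M, Submodule ℝ (EndT E x)) (X : VField E M) : Prop :=
  ∀ x₀ : M, ∃ (U : Set M) (ε : ℝ) (φ : ℝ → M → M), x₀ ∈ U ∧ IsLocalFlow X U ε φ ∧
    ∀ t ∈ Ioo (-ε) ε, ∀ x ∈ U, ∀ A ∈ Q x,
      ((mfderiv 𝓘(ℝ, E) 𝓘(ℝ, E) (φ t) x).comp A).comp
        (mfderiv 𝓘(ℝ, E) 𝓘(ℝ, E) (φ t) x).inverse ∈ Q (φ t x)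

/-- `(L_X ∇)_Y Z = L_X (∇_Y Z) - ∇_{L_X Y} Z - ∇_Y (L_X Z)`, where `L_X Y = [X, Y]`. -/
def lieDerivative (nabla : CovariantDerivative 𝓘(ℝ, E) E (TangentSpace 𝓘(ℝ, E) : M → Type _))
    (X Y Z : Π x : M, TangentSpace 𝓘(ℝ, E) x) (x : M) : TangentSpace 𝓘(ℝ, E) x :=
  VectorField.mlieBracket 𝓘(ℝ, E) X (fun y ↦ nabla Z y (Y y)) x
    - nabla Z x (VectorField.mlieBracket 𝓘(ℝ, E) X Y x)
    - nabla (VectorField.mlieBracket 𝓘(ℝ, E) X Z) x (Y x)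

/-- The curvature `R_{X,Y} Z = ∇_X ∇_Y Z - ∇_Y ∇_X Z - ∇_{[X,Y]} Z`. -/
def curvature (nabla : CovariantDerivative 𝓘(ℝ, E) E (TangentSpace 𝓘(ℝ, E) : M → Type _))
    (X Y Z : Π x : M, TangentSpace 𝓘(ℝ, E) x) (x : M) : TangentSpace 𝓘(ℝ, E) x :=
  nabla (fun y ↦ nabla Z y (Y y)) x (X x) - nabla (fun y ↦ nabla Z y (X y)) x (Y x)
    - nabla Z x (VectorField.mlieBracket 𝓘(ℝ, E) X Y x)

variable [CompleteSpace E]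

/-- For smooth `Y` and `Z`, the curvature `R_{U,Y} Z` is tensorial in `U`. -/
theorem curvature_tensorial
    (nabla : CovariantDerivative 𝓘(ℝ, E) E (TangentSpace 𝓘(ℝ, E) : M → Type _))
    [h : nabla.ContMDiffCovariantDerivative ∞] (Y Z : VField E M) (x : M) :
    TensorialAt 𝓘(ℝ, E) E (fun U ↦ curvature nabla U Y Z x) x := by
  have hY : MDiffAt (T% (fun y ↦ Y y)) x := (Y.contMDiff x).mdifferentiableAt (by simp)
  have hZ : MDiffAt (fun y : M ↦ TotalSpace.mk' (E →L[ℝ] E) (E := fun x : M ↦ EndT E x) y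
      (nabla Z y)) x := by
    have := h.contMDiff.contMDiff (σ := Z) Z.contMDiff.contMDiffOn
    exact (this.contMDiffAt Filter.univ_mem).mdifferentiableAt (by simp)
  have key {U : Π x : M, TangentSpace 𝓘(ℝ, E) x} (hU : MDiffAt (T% U) x) :
      MDiffAt (T% (fun y ↦ nabla Z y (U y))) x := hZ.clm_bundle_apply hU
  constructor
  · intro f U hf hU
    have e : (fun y ↦ nabla Z y ((f • U) y)) = f • (fun y ↦ nabla Z y (U y)) := by
      ext y; simp
    simp only [curvature]
    rw [e, nabla.isCovariantDerivativeOnUniv.leibniz (key hU) hf,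
      VectorField.mlieBracket_smul_left hf hU]
    simp
    module
  · intro U V hU hV
    have e : (fun y ↦ nabla Z y ((U + V) y))
        = (fun y ↦ nabla Z y (U y)) + (fun y ↦ nabla Z y (V y)) := by
      ext y; simp
    simp only [curvature]
    rw [e, nabla.isCovariantDerivativeOnUniv.add (key hU) (key hV),
      VectorField.mlieBracket_add_left hU hV]
    simp
    module

variable [FiniteDimensional ℝ E]

/-- `∇` is a quaternionic connection for `Q`: it is torsion-free and preserves `Q`. -/
structure IsQuaternionicConnection
    (nabla : CovariantDerivative 𝓘(ℝ, E) E (TangentSpace 𝓘(ℝ, E) : M → Type _))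
    (Q : Π x : M, Submodule ℝ (EndT E x)) : Prop where
  torsion_eq_zero : nabla.torsion = 0
  preserves : Preserves nabla Q

/-- The endomorphism `u ↦ R_{u,Y} Z` of `T_x M`. -/
def curvatureEnd (nabla : CovariantDerivative 𝓘(ℝ, E) E (TangentSpace 𝓘(ℝ, E) : M → Type _))
    [nabla.ContMDiffCovariantDerivative ∞] (Y Z : VField E M) (x : M) : EndT E x :=
  TensorialAt.mkHom (fun U ↦ curvature nabla U Y Z x) x (curvature_tensorial nabla Y Z x)

/-- The function `Tr A` for a field `A` of endomorphisms. -/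
def trace (A : Π x : M, EndT E x) (x : M) : ℝ :=
  LinearMap.trace ℝ (TangentSpace 𝓘(ℝ, E) x) (A x : TangentSpace 𝓘(ℝ, E) x →ₗ[ℝ] _)

/-- The Ricci curvature `Ric(Y, Z) = Tr (U ↦ R_{U,Y} Z)`. -/
def ricci (nabla : CovariantDerivative 𝓘(ℝ, E) E (TangentSpace 𝓘(ℝ, E) : M → Type _))
    [nabla.ContMDiffCovariantDerivative ∞] (Y Z : VField E M) : M → ℝ :=
  trace (curvatureEnd nabla Y Z)

/-- The skew-symmetric part of the Ricci curvature,
`Ric^a(Y, Z) = (Ric(Y, Z) - Ric(Z, Y)) / 2`. -/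
def ricciSkew (nabla : CovariantDerivative 𝓘(ℝ, E) E (TangentSpace 𝓘(ℝ, E) : M → Type _))
    [nabla.ContMDiffCovariantDerivative ∞] (Y Z : VField E M) (x : M) : ℝ :=
  (ricci nabla Y Z x - ricci nabla Z Y x) / 2

end QuaternionicGeometry

end

/-!
For vector fields `Y` and `Z` put `S_Y Z = (L_X ∇)_Y Z`. The theorem follows from three properties
of `S`.

* Since `∇` is torsion-free, `S` is a tensor with `S_Y Z = S_Z Y` (`lieDerivative_symm`, by the
  Jacobi identity), and the endomorphism `S_Y` is
  `Z ↦ R_{Z,Y} X - R_{Z,X} Y + (∇_Y (∇ X)) Z` (`lieEnd_apply`).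
* Hence `Tr S_Y = d (Tr ∇ X) (Y) - 2 Ric^a (X, Y)` (`trace_lieEnd`), because the trace commutes with
  covariant differentiation (`mvfderiv_trace`). So the equation of the theorem says that all the
  endomorphisms `S_Y` are traceless.
* `S_Y` normalizes `Q`: its commutator with a section `A` of `Q` is
  `L_X ∇_Y A - ∇_{[X,Y]} A - ∇_Y L_X A`, and both `∇` and `L_X` preserve the sections of `Q`
  (`IsQuaternionicConnection.exists_lieDerivative_apply`). For `L_X` this holds because
  `L_X A` is at `x` the derivative of the pullback of `A` by the flow of `X`, a curve in `Q x`
  (`IsQuaternionicField.exists_lieDerivative_mem`).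

What remains is linear algebra on a quaternionic vector space `V`. A symmetric bilinear map whose
partial maps normalize the quaternions, i.e. an element of the first prolongation of
`𝔤𝔩(n, ℍ) ⊕ 𝔰𝔭(1)`, is `u, v ↦ ξ(u) v + ξ(v) u - ∑ᵢ (ξ(Iᵢ u) Iᵢ v + ξ(Iᵢ v) Iᵢ u)` for a linear form
`ξ` (`IsQuaternionTriple.exists_eq_twist`), since the first prolongation of `𝔤𝔩(n, ℍ)` vanishes. The
trace of its partial map at `u` is `(dim V + 4) ξ(u)`, so it is zero if it is traceless
(`IsQuaternionTriple.eq_zero_of_trace_eq_zero`).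
-/

namespace QuaternionicGeometry

open Filter Module
open scoped Topology

/-! ### The algebra of operators normalizing the quaternions -/

section Prolongation

variable {V : Type*} [AddCommGroup V] [Module ℝ V]

/-- `I, J, K` satisfy the relations of the unit quaternions, so that they make `V` a quaternionic
vector space. -/
structure IsQuaternionTriple (I J K : V →ₗ[ℝ] V) : Prop where
  sq_I : ∀ v, I (I v) = -v
  sq_J : ∀ v, J (J v) = -v
  I_J : ∀ v, I (J v) = K v
  J_I : ∀ v, J (I v) = -K v

namespace IsQuaternionTriple

variable {I J K : V →ₗ[ℝ] V} (h : IsQuaternionTriple I J K)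
include h

lemma I_K (v : V) : I (K v) = -J v := by rw [← h.I_J, h.sq_I]

lemma K_J (v : V) : K (J v) = -I v := by rw [← h.I_J, h.sq_J, map_neg]

lemma J_K (v : V) : J (K v) = I v := by
  rw [← neg_neg (K v), ← h.J_I, map_neg, h.sq_J, neg_neg]

lemma K_I (v : V) : K (I v) = J v := by
  rw [← neg_neg (K (I v)), ← h.J_I, h.sq_I, map_neg, neg_neg]

lemma sq_K (v : V) : K (K v) = -v := by rw [← h.I_J (K v), h.J_K, h.sq_I]

/-- A quaternion that annihilates a nonzero vector is zero. -/
lemma eq_zero_of_apply_eq_zero {v : V} (hv : v ≠ 0) {d a b c : ℝ}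
    (H : d • v + a • I v + b • J v + c • K v = 0) : d = 0 ∧ a = 0 ∧ b = 0 ∧ c = 0 := by
  -- Multiply by the conjugate quaternion.
  have H2 : (d ^ 2 + a ^ 2 + b ^ 2 + c ^ 2) • v = 0 := by
    have e : d • (d • v + a • I v + b • J v + c • K v)
        - a • I (d • v + a • I v + b • J v + c • K v)
        - b • J (d • v + a • I v + b • J v + c • K v)
        - c • K (d • v + a • I v + b • J v + c • K v) = (d ^ 2 + a ^ 2 + b ^ 2 + c ^ 2) • v := by
      simp only [map_add, map_smul, h.sq_I, h.sq_J, h.sq_K, h.I_J, h.J_I, h.I_K, h.K_I, h.J_K,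
        h.K_J]
      module
    rw [← e, H]
    simp
  have H3 : d ^ 2 + a ^ 2 + b ^ 2 + c ^ 2 = 0 := (smul_eq_zero.1 H2).resolve_right hv
  refine ⟨?_, ?_, ?_, ?_⟩ <;> nlinarith [sq_nonneg a, sq_nonneg b, sq_nonneg c, sq_nonneg d]

/-- If `[S, I]` and `[S, J]` are imaginary quaternions, then they are the commutators of `I` and `J`
with a single imaginary quaternion `(a I + b J + c K) / 2`. -/
lemma exists_imaginary [Nontrivial V] (S : V →ₗ[ℝ] V)
    (hI : ∃ p q r : ℝ, ∀ v, S (I v) - I (S v) = p • I v + q • J v + r • K v)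
    (hJ : ∃ p q r : ℝ, ∀ v, S (J v) - J (S v) = p • I v + q • J v + r • K v) :
    ∃ a b c : ℝ, (∀ v, S (I v) = I (S v) + c • J v - b • K v) ∧
      ∀ v, S (J v) = J (S v) + a • K v - c • I v := by
  obtain ⟨v, hv⟩ := exists_ne (0 : V)
  obtain ⟨p, q, r, H⟩ := hI
  obtain ⟨p', q', r', H'⟩ := hJ
  replace H (v : V) : S (I v) = I (S v) + (p • I v + q • J v + r • K v) :=
    sub_eq_iff_eq_add'.1 (H v)
  replace H' (v : V) : S (J v) = J (S v) + (p' • I v + q' • J v + r' • K v) :=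
    sub_eq_iff_eq_add'.1 (H' v)
  -- The commutator of `S` with `I` anticommutes with `I`, so it has no component along `I`.
  have hp : p = 0 := by
    have e := H (I v)
    rw [h.sq_I, H v] at e
    simp only [map_neg, map_add, map_smul, h.sq_I, h.I_J, h.J_I, h.I_K, h.K_I] at e
    have e' : (2 * p) • v = 0 := by rw [← sub_eq_zero.2 e]; module
    simpa [hv] using e'
  have hq' : q' = 0 := by
    have e := H' (J v)
    rw [h.sq_J, H' v] at e
    simp only [map_neg, map_add, map_smul, h.sq_J, h.I_J, h.J_I, h.J_K, h.K_J] at e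
    have e' : (2 * q') • v = 0 := by rw [← sub_eq_zero.2 e]; module
    simpa [hv] using e'
  -- Since `IJ = -JI`, the mixed components are related.
  have hqp : p' = -q := by
    have e : S (I (J v)) = -S (J (I v)) := by rw [h.I_J, h.J_I, map_neg, neg_neg]
    rw [H, H', H', H] at e
    simp only [map_add, map_smul, h.sq_I, h.sq_J, h.I_J, h.J_I, h.I_K, h.K_I, h.J_K, h.K_J] at e
    have e' : (2 * (p' + q)) • v = 0 := by rw [← neg_eq_zero, ← sub_eq_zero.2 e]; module
    have := (smul_eq_zero.1 e').resolve_right hv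
    linarith
  subst hp hq' hqp
  refine ⟨r', -r, q, fun v ↦ ?_, fun v ↦ ?_⟩
  · rw [H]; module
  · rw [H']; module

/-- The symmetric bilinear map
`S(u, v) = ξ(u) v + ξ(v) u - ∑ (ξ(Iᵢ u) Iᵢ v + ξ(Iᵢ v) Iᵢ u)` attached to a linear form `ξ` on a
quaternionic vector space. -/
def twist (I J K : V →ₗ[ℝ] V) (ξ : V →ₗ[ℝ] ℝ) (u : V) : V →ₗ[ℝ] V :=
  ξ u • LinearMap.id + ξ.smulRight u - (ξ (I u) • I + (ξ ∘ₗ I).smulRight (I u))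
    - (ξ (J u) • J + (ξ ∘ₗ J).smulRight (J u)) - (ξ (K u) • K + (ξ ∘ₗ K).smulRight (K u))

omit h in
lemma twist_apply (ξ : V →ₗ[ℝ] ℝ) (u v : V) : twist I J K ξ u v =
    ξ u • v + ξ v • u - (ξ (I u) • I v + ξ (I v) • I u) - (ξ (J u) • J v + ξ (J v) • J u)
      - (ξ (K u) • K v + ξ (K v) • K u) := by
  simp [twist]

lemma trace_eq_zero : LinearMap.trace ℝ V I = 0 ∧ LinearMap.trace ℝ V J = 0 ∧
    LinearMap.trace ℝ V K = 0 := by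
  have key (A B C : V →ₗ[ℝ] V) (h₁ : A ∘ₗ B = C) (h₂ : B ∘ₗ A = -C) :
      LinearMap.trace ℝ V C = 0 := by
    have := LinearMap.trace_mul_comm ℝ A B
    rw [Module.End.mul_eq_comp, Module.End.mul_eq_comp, h₁, h₂, map_neg] at this
    linarith
  refine ⟨key J K I ?_ ?_, key K I J ?_ ?_, key I J K ?_ ?_⟩ <;> ext v <;>
    simp [h.I_J, h.J_I, h.I_K, h.K_I, h.J_K, h.K_J]

lemma trace_twist [FiniteDimensional ℝ V] (ξ : V →ₗ[ℝ] ℝ) (u : V) :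
    LinearMap.trace ℝ V (twist I J K ξ u) = (Module.finrank ℝ V + 4) * ξ u := by
  have e (f : V →ₗ[ℝ] ℝ) (w : V) : LinearMap.trace ℝ V (f.smulRight w) = f w := by
    simp
  simp only [twist, map_add, map_sub, map_smul, e, LinearMap.trace_id, h.trace_eq_zero,
    LinearMap.comp_apply, h.sq_I, h.sq_J, h.sq_K, map_neg, smul_eq_mul]
  ring

/-- A symmetric bilinear map that is complex linear for two anticommuting complex structures is
zero: the first prolongation of `𝔤𝔩(n, ℍ)` vanishes. -/
lemma eq_zero_of_commute (T : V → V → V) (symm : ∀ u v, T u v = T v u)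
    (hI : ∀ u v, T u (I v) = I (T u v)) (hJ : ∀ u v, T u (J v) = J (T u v)) (u v : V) :
    T u v = 0 := by
  have e₁ : T (I u) (J v) = J (I (T u v)) := by rw [hJ, symm, hI, symm]
  have e₂ : T (I u) (J v) = I (J (T u v)) := by rw [symm, hI, symm, hJ]
  rw [e₁, h.J_I, h.I_J] at e₂
  have e₃ : K (T u v) = 0 := by
    have : (2 : ℝ) • K (T u v) = 0 := by rw [two_smul]; nth_rw 1 [← e₂]; simp
    simpa using this
  rw [← neg_eq_zero, ← h.sq_K, e₃, map_zero]

/-- The first prolongation of `𝔤𝔩(n, ℍ) ⊕ 𝔰𝔭(1)` consists of the maps `twist I J K ξ`: a symmetric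
bilinear map whose partial maps normalize the quaternions is of this form. -/
lemma exists_eq_twist [Nontrivial V] (S : V →ₗ[ℝ] V →ₗ[ℝ] V) (symm : ∀ u v, S u v = S v u)
    (hI : ∀ u, ∃ p q r : ℝ, ∀ v, S u (I v) - I (S u v) = p • I v + q • J v + r • K v)
    (hJ : ∀ u, ∃ p q r : ℝ, ∀ v, S u (J v) - J (S u v) = p • I v + q • J v + r • K v) :
    ∃ ξ : V →ₗ[ℝ] ℝ, ∀ u, S u = twist I J K ξ u := by
  -- `S u` has the same commutators with the quaternions as `(a u • I + b u • J + c u • K) / 2`;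
  -- evaluation at a nonzero vector `w` determines the coefficients, so that they are linear in `u`.
  choose a b c HI HJ using fun u ↦ h.exists_imaginary (S u) (hI u) (hJ u)
  obtain ⟨w, hw⟩ := exists_ne (0 : V)
  have uniq {u : V} {a' b' c' : ℝ} (h₁ : S u (I w) = I (S u w) + c' • J w - b' • K w)
      (h₂ : S u (J w) = J (S u w) + a' • K w - c' • I w) : a' = a u ∧ b' = b u ∧ c' = c u := by
    rw [HI] at h₁
    rw [HJ] at h₂
    have e₁ := h.eq_zero_of_apply_eq_zero hw (d := 0) (a := 0) (b := c' - c u) (c := b u - b')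
      (by rw [← neg_eq_zero, ← sub_eq_zero.2 h₁]; module)
    have e₂ := h.eq_zero_of_apply_eq_zero hw (d := 0) (a := c u - c') (b := 0) (c := a' - a u)
      (by rw [← neg_eq_zero, ← sub_eq_zero.2 h₂]; module)
    refine ⟨?_, ?_, ?_⟩ <;> linarith
  have add (u u' : V) := uniq (u := u + u') (a' := a u + a u') (b' := b u + b u')
    (c' := c u + c u') (by simp only [map_add, LinearMap.add_apply, HI]; module)
    (by simp only [map_add, LinearMap.add_apply, HJ]; module)
  have smul (t : ℝ) (u : V) := uniq (u := t • u) (a' := t * a u) (b' := t * b u)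
    (c' := t * c u) (by simp only [map_smul, LinearMap.smul_apply, HI]; module)
    (by simp only [map_smul, LinearMap.smul_apply, HJ]; module)
  have zero := uniq (u := 0) (a' := 0) (b' := 0) (c' := 0) (by simp) (by simp)
  -- The symmetry of `S (I u) (I v)` in `u` and `v`, for `v = J u`, relates `b` and `c`; likewise
  -- that of `S (J u) (J v)`, for `v = K u`, relates `a` and `c`.
  have relI (u : V) : c (I u) = b u ∧ b (I u) = -c u := by
    by_cases hu : u = 0
    · simp [hu, ← zero.2.1, ← zero.2.2]
    have e := symm (I u) (I (J u))
    rw [HI, HI, symm (I u) (J u), symm (I (J u)) u, HI, HI, symm u (J u)] at e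
    simp only [map_add, map_sub, map_smul, map_neg, h.sq_I, h.sq_J, h.I_J, h.I_K, h.K_J] at e
    have e' := h.eq_zero_of_apply_eq_zero hu (d := b u - c (I u)) (a := b (I u) + c u)
      (b := b (J u) - c (K u)) (c := c (J u) + b (K u))
      (by rw [← sub_eq_zero.2 e]; module)
    constructor <;> linarith
  have relJ (u : V) : a (J u) = c u ∧ c (J u) = -a u := by
    by_cases hu : u = 0
    · simp [hu, ← zero.1, ← zero.2.2]
    have e := symm (J u) (J (K u))
    rw [HJ, HJ, symm (J u) (K u), symm (J (K u)) u, HJ, HJ, symm u (K u)] at e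
    simp only [map_add, map_sub, map_smul, map_neg, h.sq_J, h.J_K, h.I_K, h.sq_K, h.J_I] at e
    have e' := h.eq_zero_of_apply_eq_zero hu (d := c u - a (J u)) (a := a (K u) + c (I u))
      (b := c (J u) + a u) (c := c (K u) - a (I u))
      (by rw [← sub_eq_zero.2 e]; module)
    constructor <;> linarith
  have neg (u : V) : a (-u) = -a u := by
    rw [← neg_one_smul ℝ u, ← (smul _ _).1, neg_one_mul]
  -- Modulo operators commuting with the quaternions, `twist I J K ξ u` is
  -- `-(ξ(I u) I + ξ(J u) J + ξ(K u) K)`. So `ξ` has to satisfy `ξ ∘ I = -a / 2`, and similarly for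
  -- `J` and `K`.
  let ξ : V →ₗ[ℝ] ℝ :=
    { toFun := fun u ↦ (1 / 2) * a (I u)
      map_add' := fun u u' ↦ by rw [map_add, ← (add _ _).1]; ring
      map_smul' := fun t u ↦ by rw [map_smul, ← (smul _ _).1]; simp; ring }
  have ξI (u : V) : ξ (I u) = -(1 / 2) * a u := by
    change 1 / 2 * a (I (I u)) = _
    rw [h.sq_I, neg]; ring
  have ξJ (u : V) : ξ (J u) = -(1 / 2) * b u := by
    change 1 / 2 * a (I (J u)) = _
    rw [h.I_J, ← neg_neg (K u), ← h.J_I, neg, (relJ _).1, (relI u).1]; ring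
  have ξK (u : V) : ξ (K u) = -(1 / 2) * c u := by
    change 1 / 2 * a (I (K u)) = _
    rw [h.I_K, neg, (relJ u).1]; ring
  refine ⟨ξ, fun u ↦ ?_⟩
  ext v
  refine sub_eq_zero.1 (h.eq_zero_of_commute (fun u v ↦ S u v - twist I J K ξ u v) (fun u v ↦ ?_)
    (fun u v ↦ ?_) (fun u v ↦ ?_) u v)
  · simp only [symm u v, twist_apply]; module
  · simp only [HI, twist_apply, map_add, map_sub, map_smul, h.sq_I, h.I_J, h.J_I, h.I_K, h.K_I,
      map_neg, ξI, ξJ, ξK]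
    module
  · simp only [HJ, twist_apply, map_add, map_sub, map_smul, h.sq_J, h.I_J, h.J_I, h.J_K, h.K_J,
      map_neg, ξI, ξJ, ξK]
    module

/-- A trace-free symmetric bilinear map whose partial maps normalize the quaternions is zero. -/
lemma eq_zero_of_trace_eq_zero [FiniteDimensional ℝ V] (S : V →ₗ[ℝ] V →ₗ[ℝ] V)
    (symm : ∀ u v, S u v = S v u)
    (hI : ∀ u, ∃ p q r : ℝ, ∀ v, S u (I v) - I (S u v) = p • I v + q • J v + r • K v)
    (hJ : ∀ u, ∃ p q r : ℝ, ∀ v, S u (J v) - J (S u v) = p • I v + q • J v + r • K v)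
    (htr : ∀ u, LinearMap.trace ℝ V (S u) = 0) : S = 0 := by
  nontriviality V
  obtain ⟨ξ, hξ⟩ := h.exists_eq_twist S symm hI hJ
  have : ξ = 0 := by
    ext u
    have := htr u
    rw [hξ, h.trace_twist] at this
    exact (mul_eq_zero.1 this).resolve_left (by positivity)
  ext u v
  simp [hξ, twist_apply, this]

end IsQuaternionTriple

end Prolongation

/-! ### Extension of tensors to fields, and the covariant derivative of endomorphisms -/

section Extension

variable {E : Type*} [NormedAddCommGroup E] [NormedSpace ℝ E] [FiniteDimensional ℝ E]
  {M : Type*} [TopologicalSpace M] [ChartedSpace E M] [IsManifold 𝓘(ℝ, E) ∞ M]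
  [T2Space M]

/-- Multiplication by a suitable cut-off function extends sections which are smooth on an open set
to global smooth sections, without changing their value at a given point. -/
lemma exists_smul_contMDiff {F : Type*} [NormedAddCommGroup F] [NormedSpace ℝ F]
    {V : M → Type*} [TopologicalSpace (TotalSpace F V)] [∀ x, AddCommGroup (V x)]
    [∀ x, Module ℝ (V x)] [∀ x, TopologicalSpace (V x)] [FiberBundle F V] [VectorBundle ℝ F V]
    {U : Set M} (hU : IsOpen U) {x : M} (hx : x ∈ U) :
    ∃ χ : M → ℝ, χ x = 1 ∧ (∀ y ∉ U, χ y = 0) ∧ ∀ s : Π x : M, V x,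
      ContMDiffOn 𝓘(ℝ, E) (𝓘(ℝ, E).prod 𝓘(ℝ, F)) ∞ (T% s) U →
      ContMDiff 𝓘(ℝ, E) (𝓘(ℝ, E).prod 𝓘(ℝ, F)) ∞ (T% (χ • s)) := by
  obtain ⟨f, hf, -⟩ := (SmoothBumpFunction.nhds_basis_support
    (I := 𝓘(ℝ, E)) (hU.mem_nhds hx)).mem_iff.1 (hU.mem_nhds hx)
  refine ⟨f, f.eq_one, fun y hy ↦ ?_, fun s hs ↦ ?_⟩
  · exact image_eq_zero_of_notMem_tsupport fun h ↦ hy (hf h)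
  · exact ContMDiffOn.smul_section_of_tsupport (f.contMDiff.contMDiffOn) hU hf hs

/-- Every tangent vector is the value of a smooth vector field. -/
lemma exists_vField (x : M) (v : TangentSpace 𝓘(ℝ, E) x) : ∃ Z : VField E M, Z x = v := by
  let e := trivializationAt E (TangentSpace 𝓘(ℝ, E) : M → Type _) x
  have hx : x ∈ e.baseSet := FiberBundle.mem_baseSet_trivializationAt' x
  obtain ⟨χ, hχ, -, H⟩ := exists_smul_contMDiff (E := E) (F := E)
    (V := (TangentSpace 𝓘(ℝ, E) : M → Type _)) e.open_baseSet hx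
  let b := Module.finBasis ℝ E
  let c (i) : ℝ := (e.basisAt b hx).repr v i
  have hs := H (fun y ↦ ∑ i, c i • e.localFrame b i y) (ContMDiffOn.sum_section fun i _ ↦
    ContMDiffOn.const_smul_section (a := c i) (e.contMDiffOn_localFrame_baseSet (I := 𝓘(ℝ, E))
      ∞ b i))
  refine ⟨⟨_, hs⟩, ?_⟩
  have : χ x • ∑ i, c i • e.localFrame b i x = v := by
    rw [hχ, one_smul]
    simp_rw [e.localFrame_apply_of_mem_baseSet b hx]
    exact (e.basisAt b hx).sum_repr v
  exact this

/-- Every element of `Q` is the value of a smooth section of `Q`. -/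
lemma IsQuaternionicBundle.exists_isSection {Q : Π x : M, Submodule ℝ (EndT E x)}
    (hQ : IsQuaternionicBundle Q) {x : M} {A : EndT E x} (hA : A ∈ Q x) :
    ∃ B : Π x : M, EndT E x, IsSection Q B ∧ B x = A := by
  obtain ⟨U, hU, hx, s, hs, h⟩ := hQ.subbundle x
  obtain ⟨χ, hχ, hχ', H⟩ := exists_smul_contMDiff (E := E) (F := E →L[ℝ] E)
    (V := fun x : M ↦ EndT E x) hU hx
  rw [← (h x hx).2, Submodule.mem_span_range_iff_exists_fun] at hA
  obtain ⟨c, hc⟩ := hA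
  have hs' := H (fun y ↦ ∑ i, c i • s i y) (ContMDiffOn.sum_section fun i _ ↦
    ContMDiffOn.const_smul_section (a := c i) (hs i))
  refine ⟨_, ⟨hs'.contMDiffOn, fun y ↦ ?_⟩, ?_⟩
  · by_cases hy : y ∈ U
    · rw [← (h y hy).2]
      exact Submodule.smul_mem _ _ (Submodule.sum_mem _ fun i _ ↦
        Submodule.smul_mem _ _ (Submodule.subset_span ⟨i, rfl⟩))
    · change χ y • ∑ i, c i • s i y ∈ Q y
      rw [hχ' y hy, zero_smul]
      exact zero_mem _
  · change χ x • ∑ i, c i • s i x = A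
    rw [hχ, one_smul, hc]

end Extension

section Connection

variable {E : Type*} [NormedAddCommGroup E] [NormedSpace ℝ E] [FiniteDimensional ℝ E]
  {M : Type*} [TopologicalSpace M] [ChartedSpace E M] [IsManifold 𝓘(ℝ, E) ∞ M]
  (nabla : CovariantDerivative 𝓘(ℝ, E) E (TangentSpace 𝓘(ℝ, E) : M → Type _))

/-- A field of endomorphisms is differentiable at `x`, as a section of `End (TM)`. -/
def MDiffEndAt (A : Π x : M, EndT E x) (x : M) : Prop :=
  MDifferentiableAt 𝓘(ℝ, E) (𝓘(ℝ, E).prod 𝓘(ℝ, E →L[ℝ] E))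
    (fun y ↦ TotalSpace.mk' (E →L[ℝ] E) (E := fun x : M ↦ EndT E x) y (A y)) x

variable {nabla}

omit [FiniteDimensional ℝ E] in
lemma MDiffEndAt.apply {A : Π x : M, EndT E x} {x : M} (hA : MDiffEndAt A x)
    {Z : Π x : M, TangentSpace 𝓘(ℝ, E) x} (hZ : MDiffAt (T% Z) x) :
    MDiffAt (T% (fun y ↦ A y (Z y))) x :=
  MDifferentiableAt.clm_bundle_apply hA hZ

omit [FiniteDimensional ℝ E] in
lemma SmoothEndOn.mdiffEndAt {A : Π x : M, EndT E x} (hA : SmoothEndOn A univ) (x : M) :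
    MDiffEndAt A x :=
  (hA.contMDiffAt univ_mem).mdifferentiableAt (by simp)

omit [FiniteDimensional ℝ E] in
variable (nabla) in
/-- `∇_v (A Z) - A (∇_v Z)` depends only on the value of `Z` at `x`. -/
lemma covEnd_tensorial {A : Π x : M, EndT E x} {x : M} (hA : MDiffEndAt A x)
    (v : TangentSpace 𝓘(ℝ, E) x) :
    TensorialAt 𝓘(ℝ, E) E (fun Z ↦ nabla (fun y ↦ A y (Z y)) x v - A x (nabla Z x v)) x := by
  constructor
  · intro f Z hf hZ
    have e : (fun y ↦ A y ((f • Z) y)) = f • (fun y ↦ A y (Z y)) := by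
      ext y; simp
    rw [e, nabla.isCovariantDerivativeOnUniv.leibniz (hA.apply hZ) hf,
      nabla.isCovariantDerivativeOnUniv.leibniz hZ hf]
    simp
    module
  · intro Z W hZ hW
    have e : (fun y ↦ A y ((Z + W) y)) = (fun y ↦ A y (Z y)) + (fun y ↦ A y (W y)) := by
      ext y; simp
    rw [e, nabla.isCovariantDerivativeOnUniv.add (hA.apply hZ) (hA.apply hW),
      nabla.isCovariantDerivativeOnUniv.add hZ hW]
    simp
    module

variable (nabla) in
/-- The covariant derivative `∇_v A` of a field `A` of endomorphisms:
`(∇_v A) Z = ∇_v (A Z) - A (∇_v Z)`. -/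
noncomputable def covEnd {A : Π x : M, EndT E x} {x : M} (hA : MDiffEndAt A x)
    (v : TangentSpace 𝓘(ℝ, E) x) : EndT E x :=
  TensorialAt.mkHom _ x (covEnd_tensorial nabla hA v)

lemma covEnd_apply {A : Π x : M, EndT E x} {x : M} (hA : MDiffEndAt A x)
    (v : TangentSpace 𝓘(ℝ, E) x) {Z : Π x : M, TangentSpace 𝓘(ℝ, E) x} (hZ : MDiffAt (T% Z) x) :
    covEnd nabla hA v (Z x) = nabla (fun y ↦ A y (Z y)) x v - A x (nabla Z x v) :=
  TensorialAt.mkHom_apply _ hZ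

omit [FiniteDimensional ℝ E] in
variable (nabla) in
lemma nabla_sum {ι : Type*} (t : Finset ι) {σ : ι → Π x : M, TangentSpace 𝓘(ℝ, E) x} {x : M}
    (hσ : ∀ i ∈ t, MDiffAt (T% (σ i)) x) :
    nabla (fun y ↦ ∑ i ∈ t, σ i y) x = ∑ i ∈ t, nabla (σ i) x := by
  classical
  induction t using Finset.induction_on with
  | empty => exact nabla.isCovariantDerivativeOnUniv.zero (x := x)
  | insert a t ha h =>
    simp only [Finset.mem_insert, forall_eq_or_imp] at hσ
    simp only [Finset.sum_insert ha, ← h hσ.2]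
    exact nabla.isCovariantDerivativeOnUniv.add hσ.1 (.sum_section hσ.2)

/-- The trace is parallel: `v (Tr A) = Tr (∇_v A)`. -/
lemma mvfderiv_trace [CompleteSpace E] {A : Π x : M, EndT E x} {x : M} (hA : MDiffEndAt A x)
    (v : TangentSpace 𝓘(ℝ, E) x) :
    mvfderiv 𝓘(ℝ, E) (trace A) x v =
      LinearMap.trace ℝ (TangentSpace 𝓘(ℝ, E) x) (covEnd nabla hA v).toLinearMap := by
  -- Compute in a local frame `s` with coefficient functions `c`.
  let e := trivializationAt E (TangentSpace 𝓘(ℝ, E) : M → Type _) x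
  have hx : x ∈ e.baseSet := FiberBundle.mem_baseSet_trivializationAt' x
  let b := Module.finBasis ℝ E
  let s := e.localFrame b
  let c := e.localFrameCoeff 𝓘(ℝ, E) b
  have hs (i) : MDiffAt (T% (s i)) x :=
    (contMDiffAt_localFrame_of_mem 1 _ b i hx).mdifferentiableAt (by simp)
  have hc {σ : Π x : M, TangentSpace 𝓘(ℝ, E) x} (hσ : MDiffAt (T% σ) x) (i) :
      MDiffAt (fun y ↦ c i y (σ y)) x :=
    mdifferentiableAt_localFrameCoeff b hx hσ i
  have hc_apply (y) (hy : y ∈ e.baseSet) (w : TangentSpace 𝓘(ℝ, E) y) (i) :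
      c i y w = (e.basisAt b hy).repr w i := by
    classical
    simpa using e.localFrameCoeff_apply_of_mem_baseSet (I := 𝓘(ℝ, E)) b hy
      (Function.update 0 y w) i
  have hs_apply (y) (hy : y ∈ e.baseSet) (i) : s i y = e.basisAt b hy i :=
    e.localFrame_apply_of_mem_baseSet b hy
  have hsum (w : TangentSpace 𝓘(ℝ, E) x) : ∑ i, c i x w • s i x = w := by
    simp_rw [hc_apply x hx, hs_apply x hx]
    exact (e.basisAt b hx).sum_repr w
  have hcs (i j) : c i x (s j x) = if j = i then 1 else 0 := by
    rw [hc_apply x hx, hs_apply x hx, Basis.repr_self, Finsupp.single_apply]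
  have htr (y) (hy : y ∈ e.baseSet) (B : EndT E y) :
      LinearMap.trace ℝ (TangentSpace 𝓘(ℝ, E) y) B.toLinearMap = ∑ i, c i y (B (s i y)) := by
    rw [LinearMap.trace_eq_matrix_trace ℝ (e.basisAt b hy)]
    simp [Matrix.trace, LinearMap.toMatrix_apply, hc_apply y hy, hs_apply y hy]
  have hnabla {σ : Π x : M, TangentSpace 𝓘(ℝ, E) x} (hσ : MDiffAt (T% σ) x) :
      nabla σ x v = ∑ i, (mvfderiv 𝓘(ℝ, E) (fun y ↦ c i y (σ y)) x v • s i x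
        + c i x (σ x) • nabla (s i) x v) := by
    have h₁ (i) : MDiffAt (T% ((fun y ↦ c i y (σ y)) • s i)) x := (hc hσ i).smul_section (hs i)
    rw [nabla.isCovariantDerivativeOnUniv.congr_of_eventuallyEq hσ
      (MDifferentiableAt.sum_section (t := fun i ↦ (fun y ↦ c i y (σ y)) • s i)
        (s := Finset.univ) fun i _ ↦ h₁ i) univ_mem
      (e.eventually_eq_localFrame_sum_coeff_smul b hx), nabla_sum _ _ fun i _ ↦ h₁ i,
      sum_apply]
    refine Finset.sum_congr rfl fun i _ ↦ ?_
    rw [nabla.isCovariantDerivativeOnUniv.leibniz (hs i) (hc hσ i)]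
    simp [add_comm]
  have hd : mvfderiv 𝓘(ℝ, E) (trace A) x v =
      ∑ i, mvfderiv 𝓘(ℝ, E) (fun y ↦ c i y (A y (s i y))) x v := by
    have h₁ : trace A =ᶠ[𝓝 x] ∑ i, fun y ↦ c i y (A y (s i y)) := by
      filter_upwards [e.open_baseSet.mem_nhds hx] with y hy
      rw [Finset.sum_apply]
      exact htr y hy (A y)
    have h₂ := HasMFDerivAt.sum (t := Finset.univ) fun i _ ↦
      (hc (hA.apply (hs i)) i).hasMFDerivAt
    rw [mvfderiv, h₁.mfderiv_eq, h₂.mfderiv]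
    let D (i) : E →L[ℝ] ℝ := mvfderiv 𝓘(ℝ, E) (fun y ↦ c i y (A y (s i y))) x
    exact sum_apply Finset.univ D v
  rw [hd, htr x hx]
  simp_rw [covEnd_apply hA v (hs _), hnabla (hA.apply (hs _)), map_sub, map_sum, map_add, map_smul,
    hcs, Finset.sum_sub_distrib, Finset.sum_add_distrib]
  have e₁ (i) : A x (nabla (s i) x v) = ∑ j, c j x (nabla (s i) x v) • A x (s j x) := by
    conv_lhs => rw [← hsum (nabla (s i) x v)]
    simp
  have e₂ : ∑ i, ∑ j, c j x (A x (s i x)) • c i x (nabla (s j) x v)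
      = ∑ i, c i x (A x (nabla (s i) x v)) := by
    rw [Finset.sum_comm]
    refine Finset.sum_congr rfl fun i _ ↦ ?_
    rw [e₁, map_sum]
    refine Finset.sum_congr rfl fun j _ ↦ ?_
    simp [mul_comm]
  rw [e₂]
  simp

end Connection

/-! ### Lie brackets and flows -/

section FlowVectorSpace

lemma hasDerivAt_ringInverse {R : Type*} [NormedRing R] [NormedAlgebra ℝ R]
    [HasSummableGeomSeries R] {D : ℝ → R} {D' : R} (hD : HasDerivAt D D' 0) (h0 : D 0 = 1) :
    HasDerivAt (fun t ↦ Ring.inverse (D t)) (-D') 0 := by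
  have h1 := hasFDerivAt_ringInverse (𝕜 := ℝ) (1 : Rˣ)
  rw [Units.val_one, ← h0] at h1
  refine (h1.comp_hasDerivAt 0 hD).congr_deriv ?_
  change -(((1 : Rˣ)⁻¹ : Rˣ) * D' * ((1 : Rˣ)⁻¹ : Rˣ)) = -D'
  simp

variable {E : Type*} [NormedAddCommGroup E] [NormedSpace ℝ E] [CompleteSpace E]

/-- The inverse of a curve of operators through the identity is differentiable. -/
lemma hasDerivAt_inverse {D : ℝ → E →L[ℝ] E} {D' : E →L[ℝ] E}
    (hD : HasDerivAt D D' 0) (h0 : D 0 = ContinuousLinearMap.id ℝ E) :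
    (∀ᶠ t in 𝓝 0, (D t).IsInvertible) ∧ HasDerivAt (fun t ↦ (D t).inverse) (-D') 0 := by
  constructor
  · have h : range ((↑) : (E ≃L[ℝ] E) → E →L[ℝ] E) ∈ 𝓝 (D 0) := by
      rw [h0]
      exact ContinuousLinearEquiv.nhds (.refl ℝ E)
    exact hD.continuousAt h
  · simpa [ContinuousLinearMap.ringInverse_eq_inverse] using hasDerivAt_ringInverse hD h0

/-- If `G` is the local flow of the vector field `X` on a vector space, then the derivative at
`t = 0` of the pullback of the vector field `W` by `G (t, ·)` is the Lie bracket `[X, W]`. -/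
lemma hasDerivAt_fderiv_inverse_apply {G : ℝ × E → E} {X W : E → E} {z : E}
    (hG : ContDiffAt ℝ 2 G (0, z)) (h0 : ∀ᶠ w in 𝓝 z, G (0, w) = w)
    (hX : ∀ᶠ w in 𝓝 z, HasDerivAt (fun t ↦ G (t, w)) (X w) 0) (hW : DifferentiableAt ℝ W z) :
    (∀ᶠ t in 𝓝 0, (fderiv ℝ (fun w ↦ G (t, w)) z).IsInvertible) ∧
    HasDerivAt (fun t ↦ (fderiv ℝ (fun w ↦ G (t, w)) z).inverse (W (G (t, z))))
      (fderiv ℝ W z (X z) - fderiv ℝ X z (W z)) 0 := by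
  have hG1 : ∀ᶠ p in 𝓝 ((0 : ℝ), z), DifferentiableAt ℝ G p := by
    filter_upwards [hG.eventually (by simp)] with p hp using hp.differentiableAt (by simp)
  have hG2 : DifferentiableAt ℝ (fderiv ℝ G) (0, z) :=
    (hG.fderiv_right (m := 1) (by norm_num)).differentiableAt (by simp)
  have hsymm : IsSymmSndFDerivAt ℝ G (0, z) := hG.isSymmSndFDerivAt (by simp)
  have hline : HasDerivAt (fun t : ℝ ↦ (t, z)) (1, 0) 0 :=
    (hasDerivAt_id 0).prodMk (hasDerivAt_const 0 z)
  have hD : ∀ᶠ t in 𝓝 (0 : ℝ), fderiv ℝ (fun w ↦ G (t, w)) z =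
      (fderiv ℝ G (t, z)).comp (ContinuousLinearMap.inr ℝ ℝ E) := by
    have : Tendsto (fun t : ℝ ↦ (t, z)) (𝓝 0) (𝓝 (0, z)) := hline.continuousAt
    filter_upwards [this.eventually hG1] with t ht
    exact (ht.hasFDerivAt.comp z (hasFDerivAt_prodMk_right t z)).fderiv
  -- The vector field `X` is the partial derivative of `G` in time.
  have hX' : ∀ᶠ w in 𝓝 z, X w = fderiv ℝ G (0, w) (1, 0) := by
    have : Tendsto (fun w : E ↦ ((0 : ℝ), w)) (𝓝 z) (𝓝 (0, z)) :=
      (Continuous.prodMk_right (0 : ℝ)).continuousAt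
    filter_upwards [this.eventually hG1, hX] with w hw hw'
    have h₁ : HasDerivAt (fun t : ℝ ↦ (t, w)) (1, 0) 0 :=
      (hasDerivAt_id 0).prodMk (hasDerivAt_const 0 w)
    exact hw'.unique (hw.hasFDerivAt.comp_hasDerivAt 0 h₁)
  have hfX : HasFDerivAt X ((ContinuousLinearMap.apply ℝ E ((1 : ℝ), (0 : E))).comp
      ((fderiv ℝ (fderiv ℝ G) (0, z)).comp (ContinuousLinearMap.inr ℝ ℝ E))) z := by
    refine HasFDerivAt.congr_of_eventuallyEq ?_ hX'
    exact (ContinuousLinearMap.apply ℝ E ((1 : ℝ), (0 : E))).hasFDerivAt.comp z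
      (hG2.hasFDerivAt.comp z (hasFDerivAt_prodMk_right (0 : ℝ) z))
  have hderiv : HasDerivAt (fun t ↦ fderiv ℝ (fun w ↦ G (t, w)) z) (fderiv ℝ X z) 0 := by
    refine HasDerivAt.congr_of_eventuallyEq ?_ hD
    have h₁ := (((ContinuousLinearMap.compL ℝ E (ℝ × E) E).flip
      (ContinuousLinearMap.inr ℝ ℝ E)).hasFDerivAt.comp_hasDerivAt 0
        (hG2.hasFDerivAt.comp_hasDerivAt 0 hline))
    have h₂ : fderiv ℝ X z = ((ContinuousLinearMap.compL ℝ E (ℝ × E) E).flip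
        (ContinuousLinearMap.inr ℝ ℝ E)) (fderiv ℝ (fderiv ℝ G) (0, z) (1, 0)) := by
      rw [hfX.fderiv]
      ext w
      -- The time derivative and the space derivative of the flow commute.
      simpa using hsymm (0, w) (1, 0)
    rw [h₂]
    exact h₁
  have hid : fderiv ℝ (fun w ↦ G (0, w)) z = ContinuousLinearMap.id ℝ E := by
    rw [(show (fun w ↦ G (0, w)) =ᶠ[𝓝 z] id from h0).fderiv_eq, fderiv_id]
  obtain ⟨h₁, h₂⟩ := hasDerivAt_inverse hderiv hid
  refine ⟨h₁, ?_⟩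
  have hWG : HasDerivAt (fun t ↦ W (G (t, z))) (fderiv ℝ W z (X z)) 0 := by
    have : HasFDerivAt W (fderiv ℝ W z) (G (0, z)) := by
      rw [h0.self_of_nhds]; exact hW.hasFDerivAt
    exact this.comp_hasDerivAt 0 hX.self_of_nhds
  have := h₂.clm_apply hWG
  convert this using 1
  rw [hid, h0.self_of_nhds]
  simp
  abel

end FlowVectorSpace

section Flow

variable {E : Type*} [NormedAddCommGroup E] [NormedSpace ℝ E] [CompleteSpace E]
  {M : Type*} [TopologicalSpace M] [ChartedSpace E M] [IsManifold 𝓘(ℝ, E) ∞ M]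

/-- If `φ` is the local flow of `X`, then the derivative at `t = 0` of the curve
`t ↦ (φ_t)⁻¹_* (W (φ_t x))` in the tangent space at `x` is the Lie bracket `[X, W]`. -/
lemma IsLocalFlow.hasDerivAt_pullback {X : VField E M} {U : Set M} {ε : ℝ} {φ : ℝ → M → M}
    (h : IsLocalFlow X U ε φ) {x : M} (hx : x ∈ U) (W : VField E M) :
    (∀ᶠ t in 𝓝 (0 : ℝ), (mfderiv 𝓘(ℝ, E) 𝓘(ℝ, E) (φ t) x).IsInvertible) ∧
    HasDerivAt (F := E) (fun t ↦ (mfderiv 𝓘(ℝ, E) 𝓘(ℝ, E) (φ t) x).inverse (W (φ t x)))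
      (VectorField.mlieBracket 𝓘(ℝ, E) X W x) 0 := by
  -- `G` and `pull Z` are the flow and the vector field `Z` in the chart `κ` at `x`.
  let κ := extChartAt 𝓘(ℝ, E) x
  let G : ℝ × E → E := fun p ↦ κ (φ p.1 (κ.symm p.2))
  let τ : M → E →L[ℝ] E := fun y ↦ mfderiv 𝓘(ℝ, E) 𝓘(ℝ, E) κ y
  let val (Z : VField E M) : M → E := fun y ↦ Z y
  let A : ℝ → E →L[ℝ] E := fun t ↦ mfderiv 𝓘(ℝ, E) 𝓘(ℝ, E) (φ t) x
  let pull (Z : VField E M) : E → E :=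
    VectorField.mpullbackWithin 𝓘(ℝ, E) 𝓘(ℝ, E) κ.symm Z (range 𝓘(ℝ, E))
  have h0 : (0 : ℝ) ∈ Ioo (-ε) ε := ⟨by linarith [h.pos], h.pos⟩
  have hsrc : κ.source ∈ 𝓝 x := extChartAt_source_mem_nhds x
  have hx' : κ.symm (κ x) = x := extChartAt_to_inv x
  have hsymm : Tendsto κ.symm (𝓝 (κ x)) (𝓝 x) := by
    have := continuousAt_extChartAt_symm (I := 𝓘(ℝ, E)) x
    rwa [ContinuousAt, extChartAt_to_inv] at this
  -- `φ` maps a neighbourhood of `(0, x)` to the domain of the chart.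
  have hφ : ContMDiffAt (𝓘(ℝ, ℝ).prod 𝓘(ℝ, E)) 𝓘(ℝ, E) ∞ (fun p : ℝ × M ↦ φ p.1 p.2) (0, x) :=
    h.smooth.contMDiffAt (prod_mem_nhds (Ioo_mem_nhds h0.1 h0.2) (h.isOpen.mem_nhds hx))
  have hφsrc : ∀ᶠ t in 𝓝 (0 : ℝ), φ t x ∈ κ.source := by
    have h₁ : Tendsto (fun t : ℝ ↦ φ t x) (𝓝 0) (𝓝 (φ 0 x)) :=
      hφ.continuousAt.comp (f := fun t : ℝ ↦ (t, x)) (Continuous.prodMk_left x).continuousAt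
    rw [h.zero x hx] at h₁
    exact h₁ hsrc
  have hG : ContDiffAt ℝ 2 G (0, κ x) := by
    have h₁ : ContMDiffAt 𝓘(ℝ, E) 𝓘(ℝ, E) ∞ κ.symm (κ x) :=
      (contMDiffOn_extChartAt_symm x).contMDiffAt (extChartAt_target_mem_nhds x)
    have h₂ : ContMDiffAt (𝓘(ℝ, ℝ).prod 𝓘(ℝ, E)) 𝓘(ℝ, E) ∞ G (0, κ x) := by
      refine ContMDiffAt.comp (g := κ) (I' := 𝓘(ℝ, E)) _ ?_ (ContMDiffAt.comp_of_eq
        (g := fun p : ℝ × M ↦ φ p.1 p.2) (I' := 𝓘(ℝ, ℝ).prod 𝓘(ℝ, E))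
        (f := fun p : ℝ × E ↦ (p.1, κ.symm p.2)) hφ
        (contMDiffAt_fst.prodMk (h₁.comp_of_eq contMDiffAt_snd rfl)) (by rw [hx']))
      simp only [hx', h.zero x hx]
      exact contMDiffAt_extChartAt
    rw [← modelWithCornersSelf_prod, chartedSpaceSelf_prod] at h₂
    exact (contMDiffAt_iff_contDiffAt.1 h₂).of_le (by norm_cast)
  have hG0 : ∀ᶠ w in 𝓝 (κ x), G (0, w) = w := by
    filter_upwards [extChartAt_target_mem_nhds (I := 𝓘(ℝ, E)) x, hsymm (h.isOpen.mem_nhds hx)]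
      with w hw hw'
    simp only [G]
    rw [h.zero _ hw', κ.right_inv hw]
  have hpull (Z : VField E M) {y : M} (hy : y ∈ κ.source) :
      pull Z (κ y) = τ y (val Z y) := by
    let S : E →L[ℝ] E := mfderivWithin 𝓘(ℝ, E) 𝓘(ℝ, E) κ.symm (range 𝓘(ℝ, E)) (κ y)
    have hS : S.IsInvertible := isInvertible_mfderivWithin_extChartAt_symm (κ.map_source hy)
    have hSτ : S ∘L τ y = .id ℝ E := mfderivWithin_extChartAt_symm_comp_mfderiv_extChartAt' hy
    have h₂ : S.inverse (val Z (κ.symm (κ y))) = τ y (val Z y) := by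
      rw [hS.inverse_apply_eq, κ.left_inv hy]
      exact (congr($hSτ (val Z y))).symm
    exact h₂
  have hpulld (Z : VField E M) : DifferentiableAt ℝ (pull Z) (κ x) := by
    have h₁ : MDiffAt[univ] (fun y ↦ (Z y : TangentBundle 𝓘(ℝ, E) M)) x :=
      ((Z.contMDiff x).mdifferentiableAt (by simp)).mdifferentiableWithinAt
    have h₂ := h₁.differentiableWithinAt_mpullbackWithin_vectorField
    exact h₂.differentiableAt (by simp)
  have hGX : ∀ᶠ w in 𝓝 (κ x), HasDerivAt (fun t ↦ G (t, w)) (pull X w) 0 := by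
    filter_upwards [extChartAt_target_mem_nhds (I := 𝓘(ℝ, E)) x, hsymm (h.isOpen.mem_nhds hx)]
      with w hw hw'
    have h₁ := (h.integral _ hw' 0 h0).hasMFDerivAt (Ioo_mem_nhds h0.1 h0.2)
    have h₂ : MDiffAt κ (κ.symm w) := by
      refine mdifferentiableAt_extChartAt ?_
      rw [← extChartAt_source 𝓘(ℝ, E)]
      exact κ.map_target hw
    have h₃ : φ 0 (κ.symm w) = κ.symm w := h.zero _ hw'
    have h₄ : MDiffAt κ (φ 0 (κ.symm w)) := by rwa [h₃]
    have h₅ : HasFDerivAt (fun t ↦ G (t, w)) (τ (φ 0 (κ.symm w)) ∘L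
        (1 : ℝ →L[ℝ] ℝ).smulRight (val X (φ 0 (κ.symm w)))) 0 :=
      hasMFDerivAt_iff_hasFDerivAt.1 (h₄.hasMFDerivAt.comp 0 h₁)
    have h₆ : pull X w = τ (φ 0 (κ.symm w)) (val X (φ 0 (κ.symm w))) := by
      rw [h₃, ← hpull X (κ.map_target hw), κ.right_inv hw]
    simpa [h₆] using h₅.hasDerivAt
  have hτ : τ x = .id ℝ E := mfderiv_extChartAt_self
  have hmf : ∀ᶠ t in 𝓝 (0 : ℝ), τ (φ t x) ∘L A t = fderiv ℝ (fun w ↦ G (t, w)) (κ x) := by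
    have hκ : MDiffAt κ x := mdifferentiableAt_extChartAt (mem_chart_source E x)
    have h₁ : ∀ᶠ t in 𝓝 (0 : ℝ), DifferentiableAt ℝ G (t, κ x) := by
      have : Tendsto (fun t : ℝ ↦ (t, κ x)) (𝓝 0) (𝓝 (0, κ x)) :=
        (Continuous.prodMk_left (κ x)).continuousAt
      refine this.eventually ?_
      filter_upwards [hG.eventually (by simp)] with p hp using hp.differentiableAt (by simp)
    filter_upwards [hφsrc, h₁, Ioo_mem_nhds h0.1 h0.2] with t ht ht₁ ht₂
    have h₂ : MDiffAt (fun w ↦ G (t, w)) (κ x) :=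
      (ht₁.comp (κ x) (hasFDerivAt_prodMk_right t (κ x)).differentiableAt).mdifferentiableAt
    have h₃ : MDiffAt (φ t) x := by
      have := (h.smooth.contMDiffAt (x := (t, x))
        (prod_mem_nhds (Ioo_mem_nhds ht₂.1 ht₂.2) (h.isOpen.mem_nhds hx)))
      exact (this.comp (f := fun y : M ↦ (t, y)) x
        (contMDiffAt_const.prodMk contMDiffAt_id)).mdifferentiableAt (by simp)
    have h₄ : MDiffAt κ (φ t x) := by
      refine mdifferentiableAt_extChartAt ?_
      rwa [← extChartAt_source 𝓘(ℝ, E)]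
    have h₅ : κ ∘ φ t =ᶠ[𝓝 x] (fun w ↦ G (t, w)) ∘ κ := by
      filter_upwards [hsrc] with y hy
      simp only [G, Function.comp_apply, κ.left_inv hy]
    have h₆ : τ (φ t x) ∘L A t = fderiv ℝ (fun w ↦ G (t, w)) (κ x) ∘L τ x := by
      rw [← mfderiv_eq_fderiv]
      exact (mfderiv_comp x h₄ h₃).symm.trans (h₅.mfderiv_eq.trans (mfderiv_comp x h₂ hκ))
    rw [h₆, hτ, ContinuousLinearMap.comp_id]
  obtain ⟨h₁, h₂⟩ := hasDerivAt_fderiv_inverse_apply hG hG0 hGX (hpulld W)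
  have h₃ : ∀ᶠ t in 𝓝 (0 : ℝ), (A t).IsInvertible ∧ (A t).inverse (val W (φ t x)) =
        (fderiv ℝ (fun w ↦ G (t, w)) (κ x)).inverse (pull W (G (t, κ x))) := by
    filter_upwards [h₁, hmf, hφsrc] with t h₁ h₂ h₃
    have h₄ : (τ (φ t x)).IsInvertible := isInvertible_mfderiv_extChartAt h₃
    have h₅ : (A t).IsInvertible := by
      have : A t = (τ (φ t x)).inverse ∘L fderiv ℝ (fun w ↦ G (t, w)) (κ x) := by
        rw [← h₂, ← ContinuousLinearMap.comp_assoc, h₄.inverse_comp_self,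
          ContinuousLinearMap.id_comp]
      rw [this]
      exact h₄.inverse.comp h₁
    refine ⟨h₅, ?_⟩
    have h₆ : pull W (G (t, κ x)) = τ (φ t x) (val W (φ t x)) := by
      simp only [G, hx']
      exact hpull W h₃
    rw [h₆, ← h₂, h₄.inverse_comp_apply_of_left, h₄.inverse_apply_self]
  refine ⟨h₃.mono fun t ht ↦ ht.1, ?_⟩
  have h₄ : VectorField.mlieBracket 𝓘(ℝ, E) X W x =
      fderiv ℝ (pull W) (κ x) (pull X (κ x)) - fderiv ℝ (pull X) (κ x) (pull W (κ x)) := by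
    have h₅ : VectorField.mlieBracket 𝓘(ℝ, E) X W x = (τ x).inverse
        (VectorField.lieBracketWithin ℝ (pull X) (pull W) (κ.symm ⁻¹' univ ∩ range 𝓘(ℝ, E))
          (κ x)) := VectorField.mlieBracketWithin_apply
    rw [h₅, hτ]
    simp [VectorField.lieBracketWithin_univ, VectorField.lieBracket]
    rfl
  rw [h₄]
  exact h₂.congr_of_eventuallyEq (h₃.mono fun t ht ↦ ht.2)

end Flow

/-! ### The Lie derivative of sections of `Q` -/

section CurveInSubspace

variable {E : Type*} [NormedAddCommGroup E] [NormedSpace ℝ E] [FiniteDimensional ℝ E]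

/-- The derivative of a curve in a subspace is in the subspace. -/
lemma mem_of_hasDerivAt {F : Type*} [NormedAddCommGroup F] [NormedSpace ℝ F] {q : Submodule ℝ F}
    [FiniteDimensional ℝ q] {B : ℝ → F} {B' : F} (hB : HasDerivAt B B' 0)
    (hq : ∀ᶠ t in 𝓝 0, B t ∈ q) : B' ∈ q := by
  refine q.closed_of_finiteDimensional.mem_of_tendsto (hasDerivAt_iff_tendsto_slope.1 hB) ?_
  filter_upwards [nhdsWithin_le_nhds hq] with t ht
  exact q.smul_mem _ (q.sub_mem ht hq.self_of_nhds)

/-- A curve of operators is differentiable if it maps sufficiently many differentiable curves of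
vectors to differentiable curves. -/
lemma exists_hasDerivAt {B : ℝ → E →L[ℝ] E}
    (h : ∀ v : E, ∃ (z y : ℝ → E) (z' y' : E), HasDerivAt z z' 0 ∧ HasDerivAt y y' 0 ∧ z 0 = v ∧
      ∀ᶠ t in 𝓝 0, B t (z t) = y t) : ∃ B', HasDerivAt B B' 0 := by
  let b := Module.finBasis ℝ E
  choose z y z' y' hz hy h0 hB using fun i ↦ h (b i)
  -- The curves through a basis are assembled into curves of operators `P` and `R` with `B P = R`.
  let c (i) : E →L[ℝ] ℝ := (b.coord i).toContinuousLinearMap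
  let P : ℝ → E →L[ℝ] E := fun t ↦ ∑ i, (c i).smulRight (z i t)
  let R : ℝ → E →L[ℝ] E := fun t ↦ ∑ i, (c i).smulRight (y i t)
  have key {w : Fin (finrank ℝ E) → ℝ → E} {w' : Fin (finrank ℝ E) → E}
      (hw : ∀ i, HasDerivAt (w i) (w' i) 0) :
      HasDerivAt (fun t ↦ ∑ i, (c i).smulRight (w i t)) (∑ i, (c i).smulRight (w' i)) 0 :=
    HasDerivAt.fun_sum fun i _ ↦
      (ContinuousLinearMap.smulRightL ℝ E E (c i)).hasFDerivAt.comp_hasDerivAt 0 (hw i)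
  have hP0 : P 0 = .id ℝ E := by
    ext v
    simp [P, c, h0, b.sum_repr v]
  obtain ⟨h₁, h₂⟩ := hasDerivAt_inverse (key hz) hP0
  refine ⟨_, ((key hy).clm_comp h₂).congr_of_eventuallyEq ?_⟩
  filter_upwards [h₁, eventually_all.2 hB] with t ht hBt
  have : B t ∘L P t = R t := by
    ext v
    simp [P, R, hBt]
  change B t = R t ∘L (P t).inverse
  rw [← this, ContinuousLinearMap.comp_assoc, ht.self_comp_inverse, ContinuousLinearMap.comp_id]

/-- If conjugation by `T` maps `q` into `q'` and the dimensions agree, then conjugation by `T⁻¹`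
maps `q'` into `q`. -/
lemma inverse_conj_mem {q q' : Submodule ℝ (E →L[ℝ] E)} (hq : finrank ℝ q' = finrank ℝ q)
    {T : E →L[ℝ] E} (hT : T.IsInvertible) (h : ∀ C ∈ q, (T.comp C).comp T.inverse ∈ q')
    {A : E →L[ℝ] E} (hA : A ∈ q') : (T.inverse.comp A).comp T ∈ q := by
  let f : q →ₗ[ℝ] q' :=
    { toFun := fun C ↦ ⟨(T.comp C.1).comp T.inverse, h C.1 C.2⟩
      map_add' := fun C D ↦ by ext; simp
      map_smul' := fun t C ↦ by ext; simp }
  have hf : Function.Injective f := by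
    intro C D hCD
    ext v
    have := congr(($hCD).1 (T v))
    simp only [f, LinearMap.coe_mk, AddHom.coe_mk, ContinuousLinearMap.comp_apply,
      hT.inverse_apply_self] at this
    exact hT.injective this
  obtain ⟨C, hC⟩ := (LinearMap.injective_iff_surjective_of_finrank_eq_finrank hq.symm).1 hf ⟨A, hA⟩
  have : (T.inverse.comp A).comp T = C.1 := by
    have hC' : (T.comp C.1).comp T.inverse = A := congr(($hC).1)
    rw [← hC']
    ext v
    simp [hT]
  rw [this]
  exact C.2

end CurveInSubspace

section Fields

variable {E : Type*} [NormedAddCommGroup E] [NormedSpace ℝ E]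
  {M : Type*} [TopologicalSpace M] [ChartedSpace E M] [IsManifold 𝓘(ℝ, E) ∞ M]

lemma SmoothEndOn.add {A B : Π x : M, EndT E x} (hA : SmoothEndOn A univ)
    (hB : SmoothEndOn B univ) : SmoothEndOn (A + B) univ :=
  ContMDiffOn.add_section hA hB

lemma SmoothEndOn.sub {A B : Π x : M, EndT E x} (hA : SmoothEndOn A univ)
    (hB : SmoothEndOn B univ) : SmoothEndOn (A - B) univ :=
  ContMDiffOn.sub_section hA hB

lemma SmoothEndOn.comp {A B : Π x : M, EndT E x} (hA : SmoothEndOn A univ)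
    (hB : SmoothEndOn B univ) : SmoothEndOn (fun x ↦ (A x).comp (B x)) univ := by
  intro x hx
  have hA := (contMDiffWithinAt_hom_bundle _).1 (hA x hx)
  have hB := (contMDiffWithinAt_hom_bundle _).1 (hB x hx)
  refine (contMDiffWithinAt_hom_bundle _).2 ⟨hA.1, ?_⟩
  refine (hA.2.clm_comp hB.2).congr_of_eventuallyEq_of_mem ?_ hx
  filter_upwards [nhdsWithin_le_nhds ((trivializationAt E (TangentSpace 𝓘(ℝ, E) : M → Type _)
    x).open_baseSet.mem_nhds (mem_baseSet_trivializationAt E _ x))] with y hy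
  ext v
  simp only [ContinuousLinearMap.inCoordinates_eq hy hy, ContinuousLinearMap.comp_apply,
    ContinuousLinearEquiv.coe_coe, ContinuousLinearEquiv.symm_apply_apply]

/-- The vector field `A Z`. -/
noncomputable def SmoothEndOn.apply {A : Π x : M, EndT E x} (hA : SmoothEndOn A univ)
    (Z : VField E M) : VField E M :=
  ⟨fun y ↦ A y (Z y), ContMDiff.clm_bundle_apply (contMDiffOn_univ.1 hA) Z.contMDiff⟩

lemma VField.mdiffAt (Z : VField E M) (x : M) : MDiffAt (T% (fun y ↦ Z y)) x :=
  (Z.contMDiff x).mdifferentiableAt (by simp)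

/-- The Lie bracket of two smooth vector fields. -/
noncomputable def bracket [CompleteSpace E] (Y Z : VField E M) : VField E M :=
  ⟨VectorField.mlieBracket 𝓘(ℝ, E) Y Z,
    haveI : IsManifold 𝓘(ℝ, E) (((⊤ : ℕ∞) : ℕ∞ω) + 1) M := by simpa
    haveI : IsManifold 𝓘(ℝ, E) (minSmoothness ℝ 2) M := by
      rw [minSmoothness_of_isRCLikeNormedField]; infer_instance
    ContDiff.mlieBracket_vectorField (m := ⊤) (n := ⊤) Y.contMDiff Z.contMDiff (by simp)⟩

lemma smoothEndOn_nabla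
    (nabla : CovariantDerivative 𝓘(ℝ, E) E (TangentSpace 𝓘(ℝ, E) : M → Type _))
    [h : nabla.ContMDiffCovariantDerivative ∞] (Z : VField E M) : SmoothEndOn (nabla Z) univ :=
  h.contMDiff.contMDiff (σ := Z) Z.contMDiff.contMDiffOn

lemma IsQuaternionicBundle.finrank_eq {Q : Π x : M, Submodule ℝ (EndT E x)}
    (hQ : IsQuaternionicBundle Q) (x : M) : finrank ℝ (Q x) = 3 := by
  obtain ⟨U, -, hx, s, -, h⟩ := hQ.subbundle x
  rw [← (h x hx).2, finrank_span_eq_card (h x hx).1, Fintype.card_fin]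

/-- The Lie derivative `L_X A` of a section `A` of `Q` along a quaternionic vector field has values
in `Q`, since it is the derivative of a curve in `Q x`. -/
lemma IsQuaternionicField.exists_lieDerivative_mem [FiniteDimensional ℝ E] [CompleteSpace E]
    [T2Space M]
    {Q : Π x : M, Submodule ℝ (EndT E x)} (hQ : IsQuaternionicBundle Q) {X : VField E M}
    (hX : IsQuaternionicField Q X) {A : Π x : M, EndT E x} (hA : IsSection Q A) (x : M) :
    ∃ L ∈ Q x, ∀ Z : VField E M, L (Z x) =
      bracket X (hA.1.apply Z) x - A x (bracket X Z x) := by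
  -- The curve is the pullback `B t` of `A` by the flow. It is differentiable since it maps the
  -- pullback of a vector field `Z` to the pullback of `A Z`. The operators below are typed by the
  -- model space `E`, with which all tangent spaces are identified.
  obtain ⟨U, ε, φ, hx, h, hφ⟩ := hX x
  let T : ℝ → E →L[ℝ] E := fun t ↦ mfderiv 𝓘(ℝ, E) 𝓘(ℝ, E) (φ t) x
  let Q' : M → Submodule ℝ (E →L[ℝ] E) := fun y ↦ Q y
  let A' : M → E →L[ℝ] E := A
  let val (Z : VField E M) : M → E := fun y ↦ Z y
  let B : ℝ → E →L[ℝ] E := fun t ↦ ((T t).inverse.comp (A' (φ t x))).comp (T t)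
  let q : Submodule ℝ (E →L[ℝ] E) := Q x
  have h0 : (0 : ℝ) ∈ Ioo (-ε) ε := ⟨by linarith [h.pos], h.pos⟩
  have hT : ∀ᶠ t in 𝓝 0, (T t).IsInvertible := (h.hasDerivAt_pullback hx X).1
  have h₁ : φ 0 =ᶠ[𝓝 x] id := by
    filter_upwards [h.isOpen.mem_nhds hx] with y hy using h.zero y hy
  have h₂ : T 0 = .id ℝ E := h₁.mfderiv_eq.trans mfderiv_id
  have hB0 : B 0 = A' x := by
    simp only [B, h₂, h.zero x hx, ContinuousLinearMap.inverse_id]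
    rfl
  have hBq : ∀ᶠ t in 𝓝 0, B t ∈ q := by
    filter_upwards [hT, Ioo_mem_nhds h0.1 h0.2] with t ht ht'
    refine inverse_conj_mem (q' := Q' (φ t x)) ?_ ht (hφ t ht' x hx) (hA.2 _)
    exact (hQ.finrank_eq _).trans (hQ.finrank_eq _).symm
  have hder (Z : VField E M) : HasDerivAt (fun t ↦ (T t).inverse (val Z (φ t x)))
      (val (bracket X Z) x) 0 := (h.hasDerivAt_pullback hx Z).2
  have hBZ (Z : VField E M) : ∀ᶠ t in 𝓝 0, B t ((T t).inverse (val Z (φ t x))) =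
      (T t).inverse (val (hA.1.apply Z) (φ t x)) := by
    filter_upwards [hT] with t ht
    simp only [B, ContinuousLinearMap.comp_apply, ht.self_apply_inverse]
    rfl
  have hz0 (Z : VField E M) : (T 0).inverse (val Z (φ 0 x)) = val Z x := by
    rw [h₂, h.zero x hx, ContinuousLinearMap.inverse_id]
    rfl
  obtain ⟨L, hL⟩ : ∃ L, HasDerivAt B L 0 := by
    refine exists_hasDerivAt fun v ↦ ?_
    obtain ⟨Z, hZ⟩ := exists_vField (E := E) x v
    exact ⟨_, _, _, _, hder Z, hder (hA.1.apply Z), (hz0 Z).trans hZ, hBZ Z⟩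
  refine ⟨L, mem_of_hasDerivAt (q := q) hL hBq, fun Z ↦ ?_⟩
  have h₁ := (hL.clm_apply (hder Z)).unique
    ((hder (hA.1.apply Z)).congr_of_eventuallyEq (hBZ Z))
  rw [hz0, hB0] at h₁
  exact eq_sub_of_add_eq h₁

end Fields

/-! ### The Lie derivative of the connection -/

section Variation

variable {E : Type*} [NormedAddCommGroup E] [NormedSpace ℝ E] [FiniteDimensional ℝ E]
  [CompleteSpace E] {M : Type*} [TopologicalSpace M] [ChartedSpace E M]
  [IsManifold 𝓘(ℝ, E) ∞ M]
  (nabla : CovariantDerivative 𝓘(ℝ, E) E (TangentSpace 𝓘(ℝ, E) : M → Type _))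
  [nabla.ContMDiffCovariantDerivative ∞]

/-- The vector field `∇_Y Z`. -/
noncomputable def covField (Y Z : VField E M) : VField E M :=
  (smoothEndOn_nabla nabla Z).apply Y

omit [FiniteDimensional ℝ E] [CompleteSpace E] in
lemma covField_add_right (Y Z W : VField E M) (x : M) :
    covField nabla Y (Z + W) x = covField nabla Y Z x + covField nabla Y W x :=
  congr($(nabla.isCovariantDerivativeOnUniv.add (Z.mdiffAt x) (W.mdiffAt x)) (Y x))

omit [FiniteDimensional ℝ E] in
lemma bracket_add_right (Y Z W : VField E M) (x : M) :
    bracket Y (Z + W) x = bracket Y Z x + bracket Y W x :=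
  VectorField.mlieBracket_add_right (Z.mdiffAt x) (W.mdiffAt x)

omit [FiniteDimensional ℝ E] in
lemma bracket_swap (Y Z : VField E M) (x : M) : bracket Y Z x = -bracket Z Y x :=
  VectorField.mlieBracket_swap_apply

omit [FiniteDimensional ℝ E] in
/-- The Jacobi identity. -/
lemma bracket_bracket (X Y Z : VField E M) (x : M) :
    bracket X (bracket Y Z) x = bracket (bracket X Y) Z x + bracket Y (bracket X Z) x := by
  have h (W : VField E M) : CMDiffAt (minSmoothness ℝ 2) (T% (fun y ↦ W y)) x := by
    rw [minSmoothness_of_isRCLikeNormedField]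
    exact (W.contMDiff x).of_le (WithTop.coe_le_coe.2 (le_top : (2 : ℕ∞) ≤ ⊤))
  have : IsManifold 𝓘(ℝ, E) (minSmoothness ℝ 3) M := by
    rw [minSmoothness_of_isRCLikeNormedField]; infer_instance
  exact VectorField.leibniz_identity_mlieBracket_apply (h X) (h Y) (h Z)

omit [FiniteDimensional ℝ E] in
lemma lieDerivative_eq (X Y Z : VField E M) (x : M) :
    lieDerivative nabla X Y Z x = bracket X (covField nabla Y Z) x
      - covField nabla (bracket X Y) Z x - covField nabla Y (bracket X Z) x := rfl

variable {nabla}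

lemma bracket_eq_of_torsion_eq_zero (h : nabla.torsion = 0) (Y Z : VField E M) (x : M) :
    bracket Y Z x = covField nabla Y Z x - covField nabla Z Y x :=
  (nabla.torsion_eq_zero_iff.1 h (Y.mdiffAt x) (Z.mdiffAt x)).symm

/-- For a torsion-free connection, `(L_X ∇)_Y Z` is symmetric in `Y` and `Z`. -/
lemma lieDerivative_symm (h : nabla.torsion = 0) (X Y Z : VField E M) (x : M) :
    lieDerivative nabla X Y Z x = lieDerivative nabla X Z Y x := by
  have e₁ : covField nabla Y Z = bracket Y Z + covField nabla Z Y := by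
    ext y
    exact eq_add_of_sub_eq (bracket_eq_of_torsion_eq_zero h Y Z y).symm
  have e₂ := bracket_eq_of_torsion_eq_zero h (bracket X Y) Z x
  have e₃ := bracket_eq_of_torsion_eq_zero h Y (bracket X Z) x
  rw [lieDerivative_eq, lieDerivative_eq, e₁, bracket_add_right, bracket_bracket, e₂, e₃]
  module

variable (nabla) in
/-- The endomorphism `Z ↦ (L_X ∇)_Y Z` of the tangent space at `x`. -/
noncomputable def lieEnd (X Y : VField E M) (x : M) : EndT E x :=
  curvatureEnd nabla Y X x - curvatureEnd nabla X Y x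
    + covEnd nabla ((smoothEndOn_nabla nabla X).mdiffEndAt x) (Y x)

lemma curvatureEnd_apply (X Y Z : VField E M) (x : M) :
    curvatureEnd nabla Y Z x (X x) = covField nabla X (covField nabla Y Z) x
      - covField nabla Y (covField nabla X Z) x - covField nabla (bracket X Y) Z x :=
  TensorialAt.mkHom_apply (curvature_tensorial nabla Y Z x) (X.mdiffAt x)

lemma lieEnd_apply (h : nabla.torsion = 0) (X Y Z : VField E M) (x : M) :
    lieEnd nabla X Y x (Z x) = lieDerivative nabla X Y Z x := by
  have e₁ : covEnd nabla ((smoothEndOn_nabla nabla X).mdiffEndAt x) (Y x) (Z x) =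
      covField nabla Y (covField nabla Z X) x - covField nabla (covField nabla Y Z) X x :=
    covEnd_apply _ _ (Z.mdiffAt x)
  have e₂ := bracket_eq_of_torsion_eq_zero h X (covField nabla Z Y) x
  have e₃ : covField nabla (bracket Z Y) X x =
      covField nabla (covField nabla Z Y) X x - covField nabla (covField nabla Y Z) X x :=
    (congr(nabla X x $(bracket_eq_of_torsion_eq_zero h Z Y x))).trans (map_sub _ _ _)
  have e₄ : covField nabla (bracket X Z) Y x = -covField nabla (bracket Z X) Y x :=
    (congr(nabla Y x $(bracket_swap X Z x))).trans (map_neg _ _)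
  have e₅ : covField nabla X Y = bracket X Y + covField nabla Y X := by
    ext y
    exact eq_add_of_sub_eq (bracket_eq_of_torsion_eq_zero h X Y y).symm
  have e₆ := covField_add_right nabla Z (bracket X Y) (covField nabla Y X) x
  rw [lieDerivative_symm h, lieDerivative_eq, e₂, e₄]
  change curvatureEnd nabla Y X x (Z x) - curvatureEnd nabla X Y x (Z x)
    + covEnd nabla ((smoothEndOn_nabla nabla X).mdiffEndAt x) (Y x) (Z x) = _
  rw [curvatureEnd_apply, curvatureEnd_apply, e₁, e₃, e₅, e₆]
  module

lemma lieEnd_symm (h : nabla.torsion = 0) (X Y Z : VField E M) (x : M) :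
    lieEnd nabla X Y x (Z x) = lieEnd nabla X Z x (Y x) := by
  rw [lieEnd_apply h, lieEnd_apply h, lieDerivative_symm h]

lemma trace_lieEnd (X Y : VField E M) (x : M) :
    LinearMap.trace ℝ (TangentSpace 𝓘(ℝ, E) x) (lieEnd nabla X Y x).toLinearMap =
      mvfderiv 𝓘(ℝ, E) (trace (nabla X)) x (Y x) - 2 * ricciSkew nabla X Y x := by
  rw [mvfderiv_trace ((smoothEndOn_nabla nabla X).mdiffEndAt x)]
  simp only [lieEnd, ContinuousLinearMap.toLinearMap_add, ContinuousLinearMap.toLinearMap_sub,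
    map_add, map_sub, ricciSkew, ricci, trace]
  ring

/-- The Lie derivative of a section of `Q` along a quaternionic vector field is a section
of `Q`. -/
lemma IsQuaternionicConnection.exists_isSection_lieDerivative [T2Space M]
    {Q : Π x : M, Submodule ℝ (EndT E x)} (h : IsQuaternionicConnection nabla Q)
    (hQ : IsQuaternionicBundle Q) {X : VField E M} (hX : IsQuaternionicField Q X)
    {A : Π x : M, EndT E x} (hA : IsSection Q A) :
    ∃ A' : Π x : M, EndT E x, IsSection Q A' ∧ ∀ (Z : VField E M) (x : M),
      bracket X (hA.1.apply Z) x = A' x (Z x) + A x (bracket X Z x) := by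
  obtain ⟨B, hB, hBA⟩ := h.preserves X A hA
  have hX' := smoothEndOn_nabla nabla X
  have key (Z : VField E M) (x : M) : bracket X (hA.1.apply Z) x =
      (B x - (nabla X x).comp (A x) + (A x).comp (nabla X x)) (Z x) + A x (bracket X Z x) := by
    have e₁ : covField nabla X (hA.1.apply Z) x = B x (Z x) + A x (covField nabla X Z x) :=
      hBA Z x
    rw [bracket_eq_of_torsion_eq_zero h.torsion_eq_zero,
      bracket_eq_of_torsion_eq_zero h.torsion_eq_zero, e₁, map_sub]
    change _ - nabla X x (A x (Z x)) =
      B x (Z x) - nabla X x (A x (Z x)) + A x (nabla X x (Z x)) +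
        (A x (covField nabla X Z x) - A x (nabla X x (Z x)))
    module
  refine ⟨_, ⟨(hB.1.sub (hX'.comp hA.1)).add (hA.1.comp hX'), fun x ↦ ?_⟩, key⟩
  obtain ⟨L, hL, hLA⟩ := hX.exists_lieDerivative_mem hQ hA x
  convert hL
  ext v
  obtain ⟨Z, rfl⟩ := exists_vField x v
  exact (eq_sub_of_add_eq (key Z x).symm).trans (hLA Z).symm

/-- `(L_X ∇)_Y` normalizes `Q`: the commutator `L_X ∇_Y A - ∇_{[X,Y]} A - ∇_Y L_X A` of
`(L_X ∇)_Y` and a section `A` of `Q` is in `Q`. -/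
lemma IsQuaternionicConnection.exists_lieDerivative_apply [T2Space M]
    {Q : Π x : M, Submodule ℝ (EndT E x)} (h : IsQuaternionicConnection nabla Q)
    (hQ : IsQuaternionicBundle Q) {X : VField E M} (hX : IsQuaternionicField Q X)
    {A : Π x : M, EndT E x} (hA : IsSection Q A) (Y : VField E M) (x : M) :
    ∃ C ∈ Q x, ∀ Z : VField E M, lieDerivative nabla X Y (hA.1.apply Z) x =
      C (Z x) + A x (lieDerivative nabla X Y Z x) := by
  obtain ⟨A₁, hA₁, hA₁'⟩ := h.exists_isSection_lieDerivative hQ hX hA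
  obtain ⟨B, hB, hB'⟩ := h.preserves Y A hA
  obtain ⟨B₁, hB₁, hB₁'⟩ := h.exists_isSection_lieDerivative hQ hX hB
  obtain ⟨A₂, hA₂, hA₂'⟩ := h.preserves Y A₁ hA₁
  obtain ⟨D, hD, hD'⟩ := h.preserves (bracket X Y) A hA
  refine ⟨B₁ x - D x - A₂ x, sub_mem (sub_mem (hB₁.2 x) (hD.2 x)) (hA₂.2 x), fun Z ↦ ?_⟩
  have e₁ : covField nabla Y (hA.1.apply Z) =
      hB.1.apply Z + hA.1.apply (covField nabla Y Z) := by
    ext y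
    exact hB' Z y
  have e₂ : bracket X (hA.1.apply Z) = hA₁.1.apply Z + hA.1.apply (bracket X Z) := by
    ext y
    exact hA₁' Z y
  have e₃ : covField nabla (bracket X Y) (hA.1.apply Z) x =
      D x (Z x) + A x (covField nabla (bracket X Y) Z x) := hD' Z x
  have e₄ : covField nabla Y (hA₁.1.apply Z) x = A₂ x (Z x) + A₁ x (covField nabla Y Z x) :=
    hA₂' Z x
  have e₅ : covField nabla Y (hA.1.apply (bracket X Z)) x =
      B x (bracket X Z x) + A x (covField nabla Y (bracket X Z) x) := hB' _ x
  rw [lieDerivative_eq, lieDerivative_eq, e₁, e₂, bracket_add_right, covField_add_right, e₃, e₄,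
    e₅, hB₁', hA₁', map_sub, map_sub]
  change _ = (B₁ x (Z x) - D x (Z x) - A₂ x (Z x)) + _
  module

omit [FiniteDimensional ℝ E] [CompleteSpace E] [IsManifold 𝓘(ℝ, E) ∞ M] in
lemma IsAdmissibleFrame.isQuaternionTriple {x : M} {q : Submodule ℝ (EndT E x)}
    {I J K : EndT E x} (h : IsAdmissibleFrame q I J K) :
    IsQuaternionTriple I.toLinearMap J.toLinearMap K.toLinearMap where
  sq_I v := congr($h.sq₁ v)
  sq_J v := congr($h.sq₂ v)
  I_J v := congr($h.mul₁₂ v)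
  J_I v := neg_eq_iff_eq_neg.1 congr($h.mul₂₁ v)

/-- `L_X ∇` vanishes where all the endomorphisms `(L_X ∇)_Y` are traceless. -/
lemma IsQuaternionicConnection.lieDerivative_eq_zero [T2Space M]
    {Q : Π x : M, Submodule ℝ (EndT E x)} (h : IsQuaternionicConnection nabla Q)
    (hQ : IsQuaternionicBundle Q) {X : VField E M} (hX : IsQuaternionicField Q X) (x : M)
    (htr : ∀ Y : VField E M,
      LinearMap.trace ℝ (TangentSpace 𝓘(ℝ, E) x) (lieEnd nabla X Y x).toLinearMap = 0)
    (Y Z : VField E M) : lieDerivative nabla X Y Z x = 0 := by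
  have : FiniteDimensional ℝ (TangentSpace 𝓘(ℝ, E) x) := inferInstanceAs (FiniteDimensional ℝ E)
  choose ext hext using exists_vField (E := E) x
  have symm (u v : TangentSpace 𝓘(ℝ, E) x) :
      lieEnd nabla X (ext u) x v = lieEnd nabla X (ext v) x u := by
    have e := lieEnd_symm h.torsion_eq_zero X (ext u) (ext v) x
    rwa [hext, hext] at e
  let S : TangentSpace 𝓘(ℝ, E) x →ₗ[ℝ] TangentSpace 𝓘(ℝ, E) x →ₗ[ℝ] TangentSpace 𝓘(ℝ, E) x :=
    { toFun := fun u ↦ (lieEnd nabla X (ext u) x).toLinearMap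
      map_add' := fun u v ↦ by
        ext w
        change lieEnd nabla X (ext (u + v)) x w =
          lieEnd nabla X (ext u) x w + lieEnd nabla X (ext v) x w
        rw [symm, symm u, symm v, map_add]
      map_smul' := fun c u ↦ by
        ext w
        change lieEnd nabla X (ext (c • u)) x w = c • lieEnd nabla X (ext u) x w
        rw [symm, symm u, map_smul] }
  obtain ⟨I, J, K, hIJK⟩ := hQ.admissible x
  have comm {A : EndT E x} (hA : A ∈ Q x) (u : TangentSpace 𝓘(ℝ, E) x) : ∃ p q r : ℝ, ∀ v,
      S u (A v) - A (S u v) = p • I v + q • J v + r • K v := by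
    obtain ⟨A, hA', rfl⟩ := hQ.exists_isSection hA
    obtain ⟨C, hC, hC'⟩ := h.exists_lieDerivative_apply hQ hX hA' (ext u) x
    rw [← hIJK.span_eq, Submodule.mem_span_triple] at hC
    obtain ⟨p, q, r, rfl⟩ := hC
    refine ⟨p, q, r, fun v ↦ ?_⟩
    have e := hC' (ext v)
    rw [← lieEnd_apply h.torsion_eq_zero, ← lieEnd_apply h.torsion_eq_zero, hext] at e
    have e' : lieEnd nabla X (ext u) x (A x (ext v x)) = _ := e
    rw [hext] at e'
    exact sub_eq_of_eq_add e'
  have hS0 : S = 0 := hIJK.isQuaternionTriple.eq_zero_of_trace_eq_zero S symm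
    (comm (hIJK.span_eq ▸ Submodule.subset_span (by simp)))
    (comm (hIJK.span_eq ▸ Submodule.subset_span (by simp))) fun u ↦ htr _
  rw [lieDerivative_symm h.torsion_eq_zero, ← lieEnd_apply h.torsion_eq_zero, ← hext (Y x),
    lieEnd_symm h.torsion_eq_zero]
  exact congr($hS0 (Y x) (Z x))

end Variation

end QuaternionicGeometry

theorem proposition4p2 {n : ℕ} {M : Type*} [TopologicalSpace M] [T2Space M]
    [ChartedSpace (EuclideanSpace ℝ (Fin (4 * n))) M] [IsManifold (𝓡 (4 * n)) ∞ M]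
    (Q : Π x : M, Submodule ℝ (QuaternionicGeometry.EndT (EuclideanSpace ℝ (Fin (4 * n))) x))
    (hQ : QuaternionicGeometry.IsQuaternionicBundle Q)
    (nabla : CovariantDerivative (𝓡 (4 * n)) (EuclideanSpace ℝ (Fin (4 * n)))
      (TangentSpace (𝓡 (4 * n)) : M → Type _))
    [nabla.ContMDiffCovariantDerivative ∞]
    (hnabla : QuaternionicGeometry.IsQuaternionicConnection nabla Q)
    (X : QuaternionicGeometry.VField (EuclideanSpace ℝ (Fin (4 * n))) M)
    (hX : QuaternionicGeometry.IsQuaternionicField Q X) :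
    (∀ (Y Z : QuaternionicGeometry.VField (EuclideanSpace ℝ (Fin (4 * n))) M) (x : M),
      QuaternionicGeometry.lieDerivative nabla X Y Z x = 0) ↔
    ∀ (Z : QuaternionicGeometry.VField (EuclideanSpace ℝ (Fin (4 * n))) M) (x : M),
      2 * QuaternionicGeometry.ricciSkew nabla X Z x =
        mvfderiv (𝓡 (4 * n)) (QuaternionicGeometry.trace (nabla X)) x (Z x) := by
  refine ⟨fun h Y x ↦ ?_, fun h Y Z x ↦ ?_⟩
  · have h₀ : QuaternionicGeometry.lieEnd nabla X Y x = 0 := by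
      ext1 v
      obtain ⟨Z, rfl⟩ := QuaternionicGeometry.exists_vField x v
      exact (QuaternionicGeometry.lieEnd_apply hnabla.torsion_eq_zero X Y Z x).trans (h Y Z x)
    have htr := QuaternionicGeometry.trace_lieEnd (nabla := nabla) X Y x
    rw [h₀, ContinuousLinearMap.toLinearMap_zero, map_zero] at htr
    linarith
  · refine hnabla.lieDerivative_eq_zero hQ hX x (fun Y ↦ ?_) Y Z
    rw [QuaternionicGeometry.trace_lieEnd, h, sub_self]
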